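/- Let $n$ be a natural number and let $s_i=(i\ \,i+1)$, $1\le i\le n-1$, be the simple transpositions of $S_n$. A word is a finite sequence $R=i_1i_2\cdots i_L$ of letters in $\{1,\dots,n-1\}$; it is a reduced word of $w\in S_n$ if $s_{i_1}\cdots s_{i_L}=w$ and $L=\ell(w)$ is the Coxeter length of $w$. Two words are in the same commutation class if one is obtained from the other by finitely many moves replacing a consecutive $ij$ with $|i-j|>1$ by $ji$. Let $w_0=n(n-1)\cdots 21$ be the longest element of $S_n$. For a finite field $\mathbb F_q$ let $E_\bullet$ be the standard flag in $\mathbb F_q^n$. For $w\in S_n$ let $E^w_\bullet$ be the flag with $E^w_k=\langle e_{w(1)},\dots,e_{w(k)}\rangle$, and let $X_w^\circ=B\cdot E_\bullet^w$ be its orbit under the group $B$ of invertible upper triangular matrices. Let $\mathrm{BS}^R(\mathbb F_q)$ be the set of sequences $(F^{(0)}_\bullet,\dots,F^{(L)}_\bullet)$ of complete flags in $\mathbb F_q^n$ such that $F^{(0)}_\bullet=E_\bullet$ and $F^{(r-1)}_k=F^{(r)}_k$ for all $1\le r\le L$ and all $k\ne i_r$. Let $\pi_R$ send such a sequence to $F^{(L)}_\bullet$,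 and put $$\mathbb P_{R,q}(w)=\frac{|\pi_R^{-1}(X_w^\circ)|}{(q+1)^{L}}\qquad(w\in S_n).$$ **Proposition.** Let $R_1,R_2$ be reduced words of $w_0$ lying in different commutation classes. Then $\mathbb P_{R_1,q}\neq\mathbb P_{R_2,q}$ as rational functions of $q$. That is: for each $j\in\{1,2\}$ there is a unique family $(P_j(w))_{w\in S_n}$ of rational functions in $\mathbb Q(q)$ such that, at every prime power $q$, each $P_j(w)$ has no pole and takes the value $\mathbb P_{R_j,q}(w)$; and the families $P_1$ and $P_2$ are different. -/

import Mathlib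

/-- A word in the alphabet `{1, …, n-1}`. The element `i : Fin (n - 1)` stands for the letter
`i + 1`, that is, for the simple transposition exchanging the positions `i` and `i + 1` counted
from `0`. -/
abbrev SimpleWord (n : ℕ) : Type := List (Fin (n - 1))

/-- The simple transposition of `S_n` belonging to a letter. -/
def simpleSwap {n : ℕ} (i : Fin (n - 1)) : Equiv.Perm (Fin n) :=
  Equiv.swap ⟨(i : ℕ), by omega⟩ ⟨(i : ℕ) + 1, by omega⟩

/-- The ordinary product `w(R) = s_{i_1} s_{i_2} ⋯ s_{i_L}`. -/
def wordPerm {n : ℕ} (R : SimpleWord n) : Equiv.Perm (Fin n) :=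
  (R.map simpleSwap).prod

/-- The Coxeter length: the least length of a word with product `w`. -/
noncomputable def coxeterLength {n : ℕ} (w : Equiv.Perm (Fin n)) : ℕ :=
  sInf {k : ℕ | ∃ R : SimpleWord n, R.length = k ∧ wordPerm R = w}

/-- The set `Red(w)` of reduced words of `w`. -/
def reducedWords {n : ℕ} (w : Equiv.Perm (Fin n)) : Set (SimpleWord n) :=
  {R | wordPerm R = w ∧ R.length = coxeterLength w}

/-- The longest element `w_0 = n (n-1) ⋯ 2 1`. -/
def longestPerm (n : ℕ) : Equiv.Perm (Fin n) := Fin.revPerm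

/-- A single commutation move: a consecutive `i j` with `|i - j| > 1` is replaced by `j i`. -/
def CommutationMove {n : ℕ} (R R' : SimpleWord n) : Prop :=
  ∃ (T₁ T₂ : SimpleWord n) (i j : Fin (n - 1)),
    1 < |((i : ℕ) : ℤ) - ((j : ℕ) : ℤ)| ∧
      R = T₁ ++ [i, j] ++ T₂ ∧ R' = T₁ ++ [j, i] ++ T₂

/-- Two words lie in the same commutation class: one is obtained from the other by a finite
sequence of commutation moves. -/
def SameCommutationClass {n : ℕ} (R R' : SimpleWord n) : Prop :=
  Relation.ReflTransGen CommutationMove R R'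

/-- A complete flag `0 = F_0 ⊂ F_1 ⊂ ⋯ ⊂ F_n = K^n` with `dim F_k = k`. -/
@[ext]
structure CompleteFlag (n : ℕ) (K : Type) [Field K] where
  /-- The subspace `F_k`. -/
  space : Fin (n + 1) → Submodule K (Fin n → K)
  mono : Monotone space
  finrank_space : ∀ k, Module.finrank K (space k) = (k : ℕ)

/-- The coordinate subspace `E^w_k = ⟨e_{w(1)}, …, e_{w(k)}⟩` of `K^n`. -/
def coordSubspace {n : ℕ} (K : Type) [Field K] (w : Equiv.Perm (Fin n)) (k : Fin (n + 1)) :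
    Submodule K (Fin n → K) :=
  Submodule.span K {v | ∃ j : Fin n, (j : ℕ) < (k : ℕ) ∧ v = Pi.single (w j) (1 : K)}

/-- The Schubert cell `X_w° = B · E^w` as a set of complete flags, where `B` is the group of
invertible upper triangular matrices acting on column vectors. -/
def schubertCell {n : ℕ} (K : Type) [Field K] (w : Equiv.Perm (Fin n)) :
    Set (CompleteFlag n K) :=
  {F | ∃ b : Matrix.GeneralLinearGroup (Fin n) K,
    (b : Matrix (Fin n) (Fin n) K).BlockTriangular id ∧
      ∀ k, F.space k =
        (coordSubspace K w k).map (Matrix.mulVecLin (b : Matrix (Fin n) (Fin n) K))}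

/-- The `K`-points of the Bott–Samelson variety `BS^R`: sequences of complete flags
`F^(0), …, F^(L)` starting at the standard flag, such that `F^(r-1)` and `F^(r)` agree in every
dimension other than the `r`-th letter of `R`. -/
def bottSamelson {n : ℕ} (K : Type) [Field K] (R : SimpleWord n) :
    Set (Fin (R.length + 1) → CompleteFlag n K) :=
  {F | (∀ k, (F 0).space k = coordSubspace K 1 k) ∧
    ∀ (r : Fin R.length) (k : Fin (n + 1)), (k : ℕ) ≠ (R.get r : ℕ) + 1 →
      (F r.castSucc).space k = (F r.succ).space k}

/-- The Bott–Samelson map `π_R`, the projection to the last flag. -/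
def bottSamelsonMap {n : ℕ} (K : Type) [Field K] (R : SimpleWord n)
    (F : bottSamelson K R) : CompleteFlag n K :=
  F.1 (Fin.last R.length)

/-- The Bott–Samelson distribution over a finite field `K` with `q` elements:
`ℙ_{R,q}(w) = |π_R⁻¹(X_w°)| / (q + 1)^L`, where `L` is the length of the word `R`. -/
noncomputable def bsProb {n : ℕ} (K : Type) [Field K] (R : SimpleWord n)
    (w : Equiv.Perm (Fin n)) : ℚ :=
  (Nat.card (bottSamelsonMap K R ⁻¹' schubertCell K w) : ℚ) /
    ((Nat.card K : ℚ) + 1) ^ R.length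

/-- `P` is the Bott–Samelson distribution `ℙ_{R,q}` as a family, indexed by `w ∈ S_n`, of rational
functions of the indeterminate `q`: at every prime power `q` each `P w` has no pole and has the
value given by counting points over the field with `q` elements. -/
def IsBSRatFunc {n : ℕ} (R : SimpleWord n) (P : Equiv.Perm (Fin n) → RatFunc ℚ) : Prop :=
  ∀ (K : Type) [Field K] [Finite K] (w : Equiv.Perm (Fin n)),
    (P w).denom.eval (Nat.card K : ℚ) ≠ 0 ∧
      (P w).eval (RingHom.id ℚ) (Nat.card K : ℚ) = bsProb K R w

/-! From a flag in the cell of `v`, the `q + 1` flags adjacent at the letter `i` split into `q` in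
the cell of `stepUp v i` and one in the cell of `stepDown v i` (`exists_equiv_isAdjacent`). Hence
each fibre count is a polynomial in `q` given by the recursion `walkPoly`. The numerator and the
denominator `(q + 1) ^ L` give the rational function, and infinitely many prime fields make it
unique. The information sits in the coefficient of `q ^ (L - 1)`. There exactly one step goes down.
A reduced word of `w₀` exchanges an ascent at every letter, so this coefficient counts the letters
whose deletion leaves a word with Demazure product `w`. View the values as strands. Deleting the
crossing of strands `a < c` changes `w₀` only on the values in `[a, c]`: it raises `a`, lowers `c`,
and lowers or raises each `b` in between according to whether `b` passes left or right of the
crossing (`isMarker_demazure_iff`). Each pair crosses once, so the coefficients tell for every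
triple `a < b < c` on which side of the crossing of `a` and `c` the strand `b` passes
(`countP_skipProducts`). These sides determine the commutation class
(`sameCommutationClass_of_crossesLeft_iff`). If one word begins with `i`, then in the other word no
neighbour of `i` can precede the first `i`, for it would put some strand on the wrong side of a
crossing. So `i` commutes to the front, and induction finishes. -/

namespace BottSamelson

open Polynomial

/-! ### Positions, steps and ascending words -/

section Combinatorics

variable {n : ℕ}

/-- The left one of the two positions exchanged by a letter. -/
def lowPos (i : Fin (n - 1)) : Fin n := ⟨i, by omega⟩

/-- The right one of the two positions exchanged by a letter. -/
def highPos (i : Fin (n - 1)) : Fin n := ⟨i + 1, by omega⟩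

@[simp] lemma val_lowPos (i : Fin (n - 1)) : (lowPos i : ℕ) = i := rfl

@[simp] lemma val_highPos (i : Fin (n - 1)) : (highPos i : ℕ) = i + 1 := rfl

lemma lowPos_lt_highPos (i : Fin (n - 1)) : lowPos i < highPos i := by
  simp [Fin.lt_def]

lemma simpleSwap_eq (i : Fin (n - 1)) :
    simpleSwap i = Equiv.swap (lowPos i) (highPos i) := rfl

@[simp] lemma simpleSwap_lowPos (i : Fin (n - 1)) : simpleSwap i (lowPos i) = highPos i := by
  simp [simpleSwap_eq]

@[simp] lemma simpleSwap_highPos (i : Fin (n - 1)) : simpleSwap i (highPos i) = lowPos i := by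
  simp [simpleSwap_eq]

lemma simpleSwap_of_ne {i : Fin (n - 1)} {y : Fin n} (h₁ : y ≠ lowPos i) (h₂ : y ≠ highPos i) :
    simpleSwap i y = y :=
  Equiv.swap_apply_of_ne_of_ne h₁ h₂

@[simp] lemma simpleSwap_mul_self (i : Fin (n - 1)) :
    simpleSwap i * simpleSwap i = (1 : Equiv.Perm (Fin n)) :=
  Equiv.swap_mul_self _ _

@[simp] lemma simpleSwap_simpleSwap (i : Fin (n - 1)) (y : Fin n) :
    simpleSwap i (simpleSwap i y) = y :=
  Equiv.swap_apply_self _ _ _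

lemma symm_mul_simpleSwap (v : Equiv.Perm (Fin n)) (i : Fin (n - 1)) (b : Fin n) :
    (v * simpleSwap i).symm b = simpleSwap i (v.symm b) := by
  rw [Equiv.symm_apply_eq]; simp

lemma simpleSwap_lt_simpleSwap {i : Fin (n - 1)} {x y : Fin n} (h : x < y)
    (hne : ¬ (x = lowPos i ∧ y = highPos i)) : simpleSwap i x < simpleSwap i y := by
  simp only [simpleSwap_eq, Equiv.swap_apply_def, Fin.ext_iff, Fin.lt_def, val_lowPos,
    val_highPos] at *
  split_ifs <;> simp <;> omega

/-- The larger one of `v` and `v * s_i`. -/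
def stepUp (v : Equiv.Perm (Fin n)) (i : Fin (n - 1)) : Equiv.Perm (Fin n) :=
  if v (lowPos i) < v (highPos i) then v * simpleSwap i else v

/-- The smaller one of `v` and `v * s_i`. -/
def stepDown (v : Equiv.Perm (Fin n)) (i : Fin (n - 1)) : Equiv.Perm (Fin n) :=
  if v (lowPos i) < v (highPos i) then v else v * simpleSwap i

lemma stepUp_lowPos (u : Equiv.Perm (Fin n)) (i : Fin (n - 1)) :
    stepUp u i (lowPos i) = max (u (lowPos i)) (u (highPos i)) := by
  unfold stepUp; split_ifs with h
  · simp [max_eq_right h.le]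
  · simp [max_eq_left (not_lt.1 h)]

lemma stepUp_highPos (u : Equiv.Perm (Fin n)) (i : Fin (n - 1)) :
    stepUp u i (highPos i) = min (u (lowPos i)) (u (highPos i)) := by
  unfold stepUp; split_ifs with h
  · simp [min_eq_left h.le]
  · simp [min_eq_right (not_lt.1 h)]

lemma stepUp_of_ne (u : Equiv.Perm (Fin n)) {i : Fin (n - 1)} {y : Fin n} (h₁ : y ≠ lowPos i)
    (h₂ : y ≠ highPos i) : stepUp u i y = u y := by
  unfold stepUp; split_ifs <;> simp [simpleSwap_of_ne h₁ h₂]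

/-- The Demazure product of `v` with a word. -/
def demazure (v : Equiv.Perm (Fin n)) (R : SimpleWord n) : Equiv.Perm (Fin n) :=
  R.foldl stepUp v

/-- Every letter of the word, applied successively to `v`, exchanges an ascent. -/
def IsAscending : Equiv.Perm (Fin n) → SimpleWord n → Prop
  | _, [] => True
  | v, i :: R => v (lowPos i) < v (highPos i) ∧ IsAscending (v * simpleSwap i) R

lemma wordPerm_cons (i : Fin (n - 1)) (R : SimpleWord n) :
    wordPerm (i :: R) = simpleSwap i * wordPerm R := by
  simp [wordPerm]

/-! ### Reduced words of the longest element ascend -/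

/-- The pairs of positions that are not inverted by `v`. -/
def nonInversions (v : Equiv.Perm (Fin n)) : Finset (Fin n × Fin n) :=
  {p | p.1 < p.2 ∧ v p.1 < v p.2}

lemma mem_nonInversions {v : Equiv.Perm (Fin n)} {p : Fin n × Fin n} :
    p ∈ nonInversions v ↔ p.1 < p.2 ∧ v p.1 < v p.2 := by
  simp [nonInversions]

/-- Applying `s_i` to both positions preserves the order of every pair except the exchanged one, so
it matches up all the other non-inversions. -/
lemma card_nonInversions_mul_simpleSwap {v : Equiv.Perm (Fin n)} {i : Fin (n - 1)}
    (h : v (lowPos i) < v (highPos i)) :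
    (nonInversions (v * simpleSwap i)).card + 1 = (nonInversions v).card := by
  have hmem : (lowPos i, highPos i) ∈ nonInversions v := by
    simp [nonInversions, lowPos_lt_highPos, h]
  rw [← Finset.card_erase_add_one hmem]
  congr 1
  refine Finset.card_bij' (fun p _ => (simpleSwap i p.1, simpleSwap i p.2))
    (fun p _ => (simpleSwap i p.1, simpleSwap i p.2)) ?_ ?_ (by simp) (by simp)
  · rintro ⟨x, y⟩ hp
    simp only [mem_nonInversions, Equiv.Perm.mul_apply, Finset.mem_erase, ne_eq, Prod.mk.injEq] at hp ⊢
    have hne : ¬ (x = lowPos i ∧ y = highPos i) := by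
      rintro ⟨rfl, rfl⟩
      simp only [simpleSwap_lowPos, simpleSwap_highPos] at hp
      exact lt_asymm h hp.2
    refine ⟨?_, simpleSwap_lt_simpleSwap hp.1 hne, hp.2⟩
    rintro ⟨hx, hy⟩
    have hx' : x = highPos i := by rw [← simpleSwap_simpleSwap i x, hx, simpleSwap_lowPos]
    have hy' : y = lowPos i := by rw [← simpleSwap_simpleSwap i y, hy, simpleSwap_highPos]
    rw [hx', hy'] at hp
    exact lt_asymm hp.1 (lowPos_lt_highPos i)
  · rintro ⟨x, y⟩ hp
    simp only [mem_nonInversions, Equiv.Perm.mul_apply, Finset.mem_erase, ne_eq, Prod.mk.injEq, simpleSwap_simpleSwap] at hp ⊢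
    exact ⟨simpleSwap_lt_simpleSwap hp.2.1 hp.1, hp.2.2⟩

lemma card_nonInversions_mul_simpleSwap_of_not_lt {v : Equiv.Perm (Fin n)} {i : Fin (n - 1)}
    (h : ¬ v (lowPos i) < v (highPos i)) :
    (nonInversions (v * simpleSwap i)).card = (nonInversions v).card + 1 := by
  have hlt : (v * simpleSwap i) (lowPos i) < (v * simpleSwap i) (highPos i) := by
    have : v (lowPos i) ≠ v (highPos i) := v.injective.ne (lowPos_lt_highPos i).ne
    simpa using lt_of_le_of_ne (not_lt.1 h) this.symm
  have := card_nonInversions_mul_simpleSwap hlt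
  rw [mul_assoc, simpleSwap_mul_self, mul_one] at this
  exact this.symm

lemma nonInversions_longestPerm : nonInversions (longestPerm n) = ∅ := by
  refine Finset.eq_empty_of_forall_notMem fun p hp => ?_
  obtain ⟨h₁, h₂⟩ := mem_nonInversions.1 hp
  simp only [longestPerm, Fin.revPerm_apply, Fin.rev_lt_rev] at h₂
  exact lt_asymm h₁ h₂

lemma eq_longestPerm_of_forall_not_lt {v : Equiv.Perm (Fin n)}
    (h : ∀ i : Fin (n - 1), ¬ v (lowPos i) < v (highPos i)) : v = longestPerm n := by
  cases n with
  | zero => exact Subsingleton.elim _ _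
  | succ m =>
    have hv : StrictAnti v := by
      rw [Fin.strictAnti_iff_succ_lt]
      intro i
      refine lt_of_le_of_ne (not_lt.1 (h i)) (v.injective.ne ?_)
      simp [Fin.ext_iff]
    -- A strictly increasing surjection of `Fin` onto itself is the identity.
    have hmono : StrictMono (fun x => v (Fin.rev x)) := fun x y hxy =>
      hv (Fin.rev_lt_rev.2 hxy)
    have hid : (fun x => v (Fin.rev x)) = id := by
      refine (hmono.range_inj strictMono_id).1 ?_
      rw [Set.range_id, Set.range_eq_univ]
      exact v.surjective.comp Fin.rev_surjective
    ext x
    have := congrFun hid (Fin.rev x)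
    simp only [Fin.rev_rev, id] at this
    simp [this, longestPerm]

lemma exists_wordPerm_eq_longestPerm (k : ℕ) : ∀ v : Equiv.Perm (Fin n),
    (nonInversions v).card = k → ∃ R : SimpleWord n, R.length = k ∧
      v * wordPerm R = longestPerm n := by
  induction k with
  | zero =>
    intro v hv
    refine ⟨[], rfl, ?_⟩
    rw [Finset.card_eq_zero] at hv
    simp only [wordPerm, List.map_nil, List.prod_nil, mul_one]
    refine eq_longestPerm_of_forall_not_lt fun i hi => ?_
    have : (lowPos i, highPos i) ∈ nonInversions v := by
      simp [nonInversions, lowPos_lt_highPos, hi]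
    simp [hv] at this
  | succ k ih =>
    intro v hv
    obtain ⟨i, hi⟩ : ∃ i : Fin (n - 1), v (lowPos i) < v (highPos i) := by
      by_contra! hcon
      rw [eq_longestPerm_of_forall_not_lt (fun i => not_lt.2 (hcon i)),
        nonInversions_longestPerm] at hv
      simp at hv
    have := card_nonInversions_mul_simpleSwap hi
    obtain ⟨R, hR, hw⟩ := ih (v * simpleSwap i) (by omega)
    exact ⟨i :: R, by simp [hR], by rw [wordPerm_cons, ← mul_assoc, hw]⟩

lemma card_nonInversions_le_length : ∀ (R : SimpleWord n) (v : Equiv.Perm (Fin n)),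
    v * wordPerm R = longestPerm n → (nonInversions v).card ≤ R.length
  | [], v, h => by
    simp only [wordPerm, List.map_nil, List.prod_nil, mul_one] at h
    simp [h, nonInversions_longestPerm]
  | i :: R, v, h => by
    rw [wordPerm_cons, ← mul_assoc] at h
    have := card_nonInversions_le_length R _ h
    rw [List.length_cons]
    by_cases hi : v (lowPos i) < v (highPos i)
    · have := card_nonInversions_mul_simpleSwap hi
      omega
    · have := card_nonInversions_mul_simpleSwap_of_not_lt hi
      omega

/-- Each letter changes the number of non-inversions by one, and that number must fall to zero. With
no letter to spare, every letter lowers it. -/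
lemma isAscending_of_length_le : ∀ (R : SimpleWord n) (v : Equiv.Perm (Fin n)),
    v * wordPerm R = longestPerm n → R.length ≤ (nonInversions v).card → IsAscending v R
  | [], _, _, _ => trivial
  | i :: R, v, h, hle => by
    rw [wordPerm_cons, ← mul_assoc] at h
    rw [List.length_cons] at hle
    have hge := card_nonInversions_le_length R _ h
    by_cases hi : v (lowPos i) < v (highPos i)
    · have := card_nonInversions_mul_simpleSwap hi
      exact ⟨hi, isAscending_of_length_le R _ h (by omega)⟩
    · have := card_nonInversions_mul_simpleSwap_of_not_lt hi
      omega

lemma isAscending_of_mem_reducedWords {R : SimpleWord n}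
    (h : R ∈ reducedWords (longestPerm n)) : IsAscending 1 R := by
  obtain ⟨hw, hl⟩ := h
  refine isAscending_of_length_le R 1 (by rw [one_mul, hw]) ?_
  obtain ⟨T, hT, hTw⟩ := exists_wordPerm_eq_longestPerm _ (1 : Equiv.Perm (Fin n)) rfl
  rw [hl]
  exact Nat.sInf_le ⟨T, hT, by rw [← hTw, one_mul]⟩

/-! ### Demazure products with one skipped crossing -/

/-- Only the threshold `b` matters. The position `h` is a discrepancy, where `v` is at least `b` and
`u` is below, with no opposite discrepancy to its left and with `b` at or left of it in `v`. Each
letter preserves such a discrepancy, possibly moving it; when `v` reaches `w₀` it can only sit at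
`Fin.rev b`. -/
lemma demazure_rev_lt : ∀ (R : SimpleWord n) (v u : Equiv.Perm (Fin n)) (b h : Fin n),
    IsAscending v R → v * wordPerm R = longestPerm n → b ≤ v h → v.symm b ≤ h → u h < b →
    (∀ y < h, b ≤ u y → b ≤ v y) → demazure u R (Fin.rev b) < b
  | [], v, u, b, h, _, hw, h₁, h₂, h₃, _ => by
    simp only [wordPerm, List.map_nil, List.prod_nil, mul_one] at hw
    subst hw
    simp only [longestPerm, Fin.revPerm_apply, Fin.revPerm_symm] at h₁ h₂
    have : h = Fin.rev b := le_antisymm (Fin.le_rev_iff.1 h₁) h₂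
    simpa [demazure, ← this] using h₃
  | i :: R, v, u, b, h, hasc, hw, h₁, h₂, h₃, h₄ => by
    rw [wordPerm_cons, ← mul_assoc] at hw
    have hi := hasc.1
    have hlh := lowPos_lt_highPos i
    have key : ∀ h', b ≤ (v * simpleSwap i) h' → (v * simpleSwap i).symm b ≤ h' →
        stepUp u i h' < b → (∀ y < h', b ≤ stepUp u i y → b ≤ (v * simpleSwap i) y) →
        demazure u (i :: R) (Fin.rev b) < b := fun h' a₁ a₂ a₃ a₄ =>
      demazure_rev_lt R (v * simpleSwap i) (stepUp u i) b h' hasc.2 hw a₁ a₂ a₃ a₄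
    have hadj : ∀ y : Fin n, y < highPos i → y ≠ lowPos i → y < lowPos i := by
      intro y; simp only [Fin.lt_def, ne_eq, Fin.ext_iff, val_lowPos, val_highPos]; omega
    have hadj' : ∀ y : Fin n, lowPos i < y → y ≠ highPos i → highPos i < y := by
      intro y; simp only [Fin.lt_def, ne_eq, Fin.ext_iff, val_lowPos, val_highPos]; omega
    simp only [symm_mul_simpleSwap, Equiv.Perm.mul_apply] at key
    have e₁ := stepUp_lowPos u i
    have e₂ := stepUp_highPos u i
    have e₃ : ∀ y, y ≠ lowPos i → y ≠ highPos i → stepUp u i y = u y :=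
      fun y a b => stepUp_of_ne u a b
    have f₁ := simpleSwap_lowPos i
    have f₂ := simpleSwap_highPos i
    have f₃ : ∀ y, y ≠ lowPos i → y ≠ highPos i → simpleSwap i y = y :=
      fun y a b => simpleSwap_of_ne a b
    have hvb : v (v.symm b) = b := by simp
    generalize v.symm b = g at *
    by_cases c₁ : h = lowPos i
    · subst c₁
      apply key (highPos i) <;> grind
    by_cases c₂ : h = highPos i
    · subst c₂
      by_cases c₃ : b ≤ v (lowPos i)
      · apply key (highPos i) <;> grind
      -- Here `v (lowPos i) < b`, so `u (lowPos i) < b` since there is no opposite discrepancy to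
      -- the left. Both values of `u` are below `b`, and the discrepancy moves left with the large
      -- value of `v`.
      · apply key (lowPos i) <;> grind
    · apply key h <;> grind

/-- Mirror image of `demazure_rev_lt`, with positions and values both reversed. -/
lemma lt_demazure_rev : ∀ (R : SimpleWord n) (v u : Equiv.Perm (Fin n)) (b h : Fin n),
    IsAscending v R → v * wordPerm R = longestPerm n → v h ≤ b → h ≤ v.symm b → b < u h →
    (∀ y, h < y → u y ≤ b → v y ≤ b) → b < demazure u R (Fin.rev b)
  | [], v, u, b, h, _, hw, h₁, h₂, h₃, _ => by
    simp only [wordPerm, List.map_nil, List.prod_nil, mul_one] at hw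
    subst hw
    simp only [longestPerm, Fin.revPerm_apply, Fin.revPerm_symm] at h₁ h₂
    have : h = Fin.rev b := le_antisymm h₂ (Fin.rev_le_iff.1 h₁)
    simpa [demazure, ← this] using h₃
  | i :: R, v, u, b, h, hasc, hw, h₁, h₂, h₃, h₄ => by
    rw [wordPerm_cons, ← mul_assoc] at hw
    have hi := hasc.1
    have hlh := lowPos_lt_highPos i
    have key : ∀ h', (v * simpleSwap i) h' ≤ b → h' ≤ (v * simpleSwap i).symm b →
        b < stepUp u i h' → (∀ y, h' < y → stepUp u i y ≤ b → (v * simpleSwap i) y ≤ b) →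
        b < demazure u (i :: R) (Fin.rev b) := fun h' a₁ a₂ a₃ a₄ =>
      lt_demazure_rev R (v * simpleSwap i) (stepUp u i) b h' hasc.2 hw a₁ a₂ a₃ a₄
    have hadj : ∀ y : Fin n, y < highPos i → y ≠ lowPos i → y < lowPos i := by
      intro y; simp only [Fin.lt_def, ne_eq, Fin.ext_iff, val_lowPos, val_highPos]; omega
    have hadj' : ∀ y : Fin n, lowPos i < y → y ≠ highPos i → highPos i < y := by
      intro y; simp only [Fin.lt_def, ne_eq, Fin.ext_iff, val_lowPos, val_highPos]; omega
    simp only [symm_mul_simpleSwap, Equiv.Perm.mul_apply] at key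
    have e₁ := stepUp_lowPos u i
    have e₂ := stepUp_highPos u i
    have e₃ : ∀ y, y ≠ lowPos i → y ≠ highPos i → stepUp u i y = u y :=
      fun y a b => stepUp_of_ne u a b
    have f₁ := simpleSwap_lowPos i
    have f₂ := simpleSwap_highPos i
    have f₃ : ∀ y, y ≠ lowPos i → y ≠ highPos i → simpleSwap i y = y :=
      fun y a b => simpleSwap_of_ne a b
    have hvb : v (v.symm b) = b := by simp
    generalize v.symm b = g at *
    by_cases c₁ : h = highPos i
    · subst c₁
      apply key (lowPos i) <;> grind
    by_cases c₂ : h = lowPos i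
    · subst c₂
      by_cases c₃ : v (highPos i) ≤ b
      · apply key (lowPos i) <;> grind
      · apply key (highPos i) <;> grind
    · apply key h <;> grind

/-- A value outside an interval compares in the same way with all values inside it. So every letter
exchanging an ascent of `v` moves the outside values identically in `u`. -/
lemma demazure_rev_eq : ∀ (R : SimpleWord n) (v u : Equiv.Perm (Fin n)) (a c : Fin n),
    IsAscending v R → v * wordPerm R = longestPerm n →
    (∀ y, v y ∈ Set.Icc a c → u y ∈ Set.Icc a c) → (∀ y, v y ∉ Set.Icc a c → u y = v y) →
    ∀ x, x ∉ Set.Icc a c → demazure u R (Fin.rev x) = x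
  | [], v, u, a, c, _, hw, _, h₂, x, hx => by
    simp only [wordPerm, List.map_nil, List.prod_nil, mul_one] at hw
    subst hw
    simp only [longestPerm, Fin.revPerm_apply] at h₂
    simpa [demazure] using h₂ (Fin.rev x) (by simpa using hx)
  | i :: R, v, u, a, c, hasc, hw, h₁, h₂, x, hx => by
    rw [wordPerm_cons, ← mul_assoc] at hw
    have hi := hasc.1
    have e₁ := stepUp_lowPos u i
    have e₂ := stepUp_highPos u i
    have e₃ : ∀ y, y ≠ lowPos i → y ≠ highPos i → stepUp u i y = u y :=
      fun y a b => stepUp_of_ne u a b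
    have f₁ := simpleSwap_lowPos i
    have f₂ := simpleSwap_highPos i
    have f₃ : ∀ y, y ≠ lowPos i → y ≠ highPos i → simpleSwap i y = y :=
      fun y a b => simpleSwap_of_ne a b
    refine demazure_rev_eq R (v * simpleSwap i) (stepUp u i) a c hasc.2 hw ?_ ?_ x hx
    all_goals
      intro y
      simp only [Set.mem_Icc, Equiv.Perm.mul_apply] at h₁ h₂ ⊢
      have a₁ := h₁ (lowPos i)
      have a₂ := h₁ (highPos i)
      have a₃ := h₂ (lowPos i)
      have a₄ := h₂ (highPos i)
      have a₅ := h₁ y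
      have a₆ := h₂ y
      by_cases c₁ : y = lowPos i
      · subst c₁; grind
      by_cases c₂ : y = highPos i
      · subst c₂; grind
      · grind

end Combinatorics

/-! ### The commutation class is determined by the products with one skipped letter -/

section CommutationClasses

variable {n : ℕ}

/-- The multiset of the Demazure products in which one letter of the word acts downwards. -/
def skipProducts : Equiv.Perm (Fin n) → SimpleWord n → Multiset (Equiv.Perm (Fin n))
  | _, [] => 0
  | v, i :: R => demazure (stepDown v i) R ::ₘ skipProducts (stepUp v i) R

/-- The permutations which differ from the longest element by moving the values in the interval
`[a, c]` only, with `a`, `b`, `c` moved in prescribed directions. -/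
def IsMarker (a b c : Fin n) (w : Equiv.Perm (Fin n)) : Prop :=
  w (Fin.rev b) < b ∧ a < w (Fin.rev a) ∧ w (Fin.rev c) < c ∧
    ∀ x, x ∉ Set.Icc a c → w (Fin.rev x) = x

/-- When the letters of the word are applied successively to `v`, the letter that exchanges
the values `a` and `c` finds the value `b` to the left of them. -/
def CrossesLeft (a b c : Fin n) : Equiv.Perm (Fin n) → SimpleWord n → Prop
  | _, [] => False
  | v, i :: R =>
    if v (lowPos i) = a ∧ v (highPos i) = c then v.symm b < lowPos i
    else CrossesLeft a b c (v * simpleSwap i) R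

/-- Compares the path `v` that skips `i` with the full path `v * simpleSwap i`. They differ only at
the two positions of `i`, which serve as the initial discrepancies. -/
lemma isMarker_demazure_iff {v : Equiv.Perm (Fin n)} {i : Fin (n - 1)} {R : SimpleWord n}
    (hasc : IsAscending v (i :: R)) (hw : v * wordPerm (i :: R) = longestPerm n)
    {a b c : Fin n} (hab : a < b) (hbc : b < c) :
    IsMarker a b c (demazure v R) ↔
      v (lowPos i) = a ∧ v (highPos i) = c ∧ v.symm b < lowPos i := by
  rw [wordPerm_cons, ← mul_assoc] at hw
  obtain ⟨hi, hasc⟩ := hasc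
  have f₁ := simpleSwap_lowPos i
  have f₂ := simpleSwap_highPos i
  have f₃ : ∀ y, y ≠ lowPos i → y ≠ highPos i → simpleSwap i y = y :=
    fun y a b => simpleSwap_of_ne a b
  have hlh := lowPos_lt_highPos i
  have hadj : ∀ y : Fin n, y < highPos i → y ≠ lowPos i → y < lowPos i := by
    intro y; simp only [Fin.lt_def, ne_eq, Fin.ext_iff, val_lowPos, val_highPos]; omega
  have hout : ∀ x, x ∉ Set.Icc (v (lowPos i)) (v (highPos i)) →
      demazure v R (Fin.rev x) = x := by
    refine demazure_rev_eq R _ v _ _ hasc hw ?_ ?_ <;>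
    · intro y
      simp only [Equiv.Perm.mul_apply, Set.mem_Icc]
      by_cases c₁ : y = lowPos i
      · subst c₁; grind
      by_cases c₂ : y = highPos i
      · subst c₂; grind
      · grind
  have hleft : ∀ x, x ≤ v (highPos i) → v (lowPos i) < x →
      (x = v (highPos i) ∨ v.symm x < lowPos i) → demazure v R (Fin.rev x) < x := by
    intro x h₁ h₂ h₃
    refine demazure_rev_lt R _ v x (lowPos i) hasc hw (by simpa using h₁) ?_ h₂ ?_
    · rw [symm_mul_simpleSwap]
      rcases h₃ with rfl | h₃
      · simp
      · rw [f₃ _ h₃.ne (h₃.trans hlh).ne]; exact h₃.le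
    · intro y hy
      simp [f₃ y hy.ne (hy.trans hlh).ne]
  have hright : ∀ x, x < v (highPos i) → v (lowPos i) ≤ x →
      (x = v (lowPos i) ∨ highPos i < v.symm x) → x < demazure v R (Fin.rev x) := by
    intro x h₁ h₂ h₃
    refine lt_demazure_rev R _ v x (highPos i) hasc hw (by simpa using h₂) ?_ h₁ ?_
    · rw [symm_mul_simpleSwap]
      rcases h₃ with rfl | h₃
      · simp
      · rw [f₃ _ (hlh.trans h₃).ne' h₃.ne']; exact h₃.le
    · intro y hy
      simp [f₃ y (hlh.trans hy).ne' hy.ne']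
  simp only [Set.mem_Icc] at hout
  constructor
  · rintro ⟨hb, ha, hc, ho⟩
    simp only [Set.mem_Icc] at ho
    have l₁ := hleft (v (highPos i)) le_rfl hi (Or.inl rfl)
    have l₂ := hright (v (lowPos i)) hi le_rfl (Or.inl rfl)
    -- `a` and `c` are moved, hence lie between the two crossing values; these are moved too, hence
    -- lie in `[a, c]`. So the two intervals coincide.
    have ea : v (lowPos i) = a := by grind
    have ec : v (highPos i) = c := by grind
    refine ⟨ea, ec, ?_⟩
    have hvb : v (v.symm b) = b := by simp
    by_contra hcon
    have : b < demazure v R (Fin.rev b) := by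
      apply hright b (by grind) (by grind)
      right
      generalize v.symm b = g at *
      grind
    exact lt_asymm hb this
  · rintro ⟨rfl, rfl, hb⟩
    exact ⟨hleft b hbc.le hab (Or.inr hb), hright _ hi le_rfl (Or.inl rfl),
      hleft _ le_rfl hi (Or.inl rfl), by simpa using hout⟩

/-! ### Inversions persist along ascending words -/

lemma symm_lt_symm_mul_simpleSwap {v : Equiv.Perm (Fin n)} {i : Fin (n - 1)} {a c : Fin n}
    (h : v.symm a < v.symm c) (hne : ¬ (v (lowPos i) = a ∧ v (highPos i) = c)) :
    (v * simpleSwap i).symm a < (v * simpleSwap i).symm c := by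
  rw [symm_mul_simpleSwap, symm_mul_simpleSwap]
  refine simpleSwap_lt_simpleSwap h ?_
  rintro ⟨h₁, h₂⟩
  exact hne ⟨by simp [← h₁], by simp [← h₂]⟩

lemma symm_lt_symm_mul_simpleSwap_of_lt {v : Equiv.Perm (Fin n)} {i : Fin (n - 1)} {a c : Fin n}
    (hi : v (lowPos i) < v (highPos i)) (hac : a < c) (h : v.symm c < v.symm a) :
    (v * simpleSwap i).symm c < (v * simpleSwap i).symm a :=
  symm_lt_symm_mul_simpleSwap h (by rintro ⟨rfl, rfl⟩; exact lt_asymm hi hac)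

lemma not_crossesLeft_of_symm_lt {a b c : Fin n} (hac : a < c) : ∀ (R : SimpleWord n)
    (v : Equiv.Perm (Fin n)), IsAscending v R → v.symm c < v.symm a → ¬ CrossesLeft a b c v R
  | [], _, _, _ => id
  | i :: R, v, hasc, h => by
    rw [CrossesLeft, if_neg]
    · exact not_crossesLeft_of_symm_lt hac R _ hasc.2
        (symm_lt_symm_mul_simpleSwap_of_lt hasc.1 hac h)
    · rintro ⟨rfl, rfl⟩
      simp only [Equiv.symm_apply_apply] at h
      exact lt_asymm h (lowPos_lt_highPos i)

lemma not_crossesLeft_of_symm_lt_middle {a b c : Fin n} (hbc : b < c) : ∀ (R : SimpleWord n)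
    (v : Equiv.Perm (Fin n)), IsAscending v R → v.symm c < v.symm b → ¬ CrossesLeft a b c v R
  | [], _, _, _ => id
  | i :: R, v, hasc, h => by
    rw [CrossesLeft]
    split_ifs with hp
    · obtain ⟨rfl, rfl⟩ := hp
      simp only [Equiv.symm_apply_apply] at h
      exact fun h' => lt_asymm h (h'.trans (lowPos_lt_highPos i))
    · exact not_crossesLeft_of_symm_lt_middle hbc R _ hasc.2
        (symm_lt_symm_mul_simpleSwap_of_lt hasc.1 hbc h)

/-- Once `b` has passed to the left of `a` it stays there, and `a` and `c` still have to cross on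
the way to `w₀`. -/
lemma crossesLeft_of_symm_lt {a b c : Fin n} (hab : a < b) (hbc : b < c) : ∀ (R : SimpleWord n)
    (v : Equiv.Perm (Fin n)), IsAscending v R → v * wordPerm R = longestPerm n →
      v.symm b < v.symm a → v.symm a < v.symm c → CrossesLeft a b c v R
  | [], v, _, hw, _, h => by
    simp only [wordPerm, List.map_nil, List.prod_nil, mul_one] at hw
    subst hw
    simp only [longestPerm, Fin.revPerm_symm, Fin.revPerm_apply, Fin.rev_lt_rev] at h
    exact absurd h (hab.trans hbc).not_gt
  | i :: R, v, hasc, hw, h, h' => by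
    rw [CrossesLeft]
    split_ifs with hp
    · rw [← hp.1] at h
      simpa using h
    · rw [wordPerm_cons, ← mul_assoc] at hw
      exact crossesLeft_of_symm_lt hab hbc R _ hasc.2 hw
        (symm_lt_symm_mul_simpleSwap_of_lt hasc.1 hab h) (symm_lt_symm_mul_simpleSwap h' hp)

-- Only the letter exchanging `a` and `c` can yield a marker for `a b c`, and an ascending word
-- exchanges them at most once.
open Classical in
lemma countP_skipProducts {a b c : Fin n} (hab : a < b) (hbc : b < c) : ∀ (R : SimpleWord n)
    (v : Equiv.Perm (Fin n)), IsAscending v R → v * wordPerm R = longestPerm n →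
      (skipProducts v R).countP (IsMarker a b c) = if CrossesLeft a b c v R then 1 else 0
  | [], v, _, _ => by simp [skipProducts, CrossesLeft]
  | i :: R, v, hasc, hw => by
    have hmark := isMarker_demazure_iff hasc hw hab hbc
    rw [wordPerm_cons, ← mul_assoc] at hw
    have ih := countP_skipProducts hab hbc R _ hasc.2 hw
    rw [skipProducts, Multiset.countP_cons, stepDown, stepUp, if_pos hasc.1, if_pos hasc.1, ih,
      hmark, CrossesLeft]
    by_cases hp : v (lowPos i) = a ∧ v (highPos i) = c
    · have : ¬ CrossesLeft a b c (v * simpleSwap i) R := by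
        refine not_crossesLeft_of_symm_lt (hab.trans hbc) R _ hasc.2 ?_
        rw [symm_mul_simpleSwap, symm_mul_simpleSwap, ← hp.1, ← hp.2]
        simpa using lowPos_lt_highPos i
      simp [this, hp]
    · have : ¬ (v (lowPos i) = a ∧ v (highPos i) = c ∧ v.symm b < lowPos i) :=
        fun h => hp ⟨h.1, h.2.1⟩
      simp only [if_neg hp, if_neg this, add_zero]

/-! ### Commutation moves -/

/-- Two letters whose simple transpositions are disjoint. -/
def IsFar (i j : Fin (n - 1)) : Prop := 1 < |((i : ℕ) : ℤ) - ((j : ℕ) : ℤ)|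

lemma isFar_iff {i j : Fin (n - 1)} :
    IsFar i j ↔ (i : ℕ) + 1 < j ∨ (j : ℕ) + 1 < i := by
  unfold IsFar; rw [lt_abs]; omega

lemma IsFar.ne {i j : Fin (n - 1)} (h : IsFar i j) :
    lowPos i ≠ lowPos j ∧ lowPos i ≠ highPos j ∧ highPos i ≠ lowPos j ∧
      highPos i ≠ highPos j := by
  rw [isFar_iff] at h
  simp only [ne_eq, Fin.ext_iff, val_lowPos, val_highPos]
  omega

lemma IsFar.symm {i j : Fin (n - 1)} (h : IsFar i j) : IsFar j i := by
  rw [isFar_iff] at h ⊢; omega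

lemma IsFar.simpleSwap_mul {i j : Fin (n - 1)} (h : IsFar i j) :
    simpleSwap i * simpleSwap j = (simpleSwap j * simpleSwap i : Equiv.Perm (Fin n)) := by
  obtain ⟨h₁, h₂, h₃, h₄⟩ := h.ne
  refine (Equiv.Perm.Disjoint.commute fun x => ?_).eq
  by_cases hx : x = lowPos i ∨ x = highPos i
  · right; rcases hx with rfl | rfl <;> exact simpleSwap_of_ne ‹_› ‹_›
  · left; push Not at hx; exact simpleSwap_of_ne hx.1 hx.2

lemma IsFar.simpleSwap_lowPos {i j : Fin (n - 1)} (h : IsFar i j) :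
    simpleSwap i (lowPos j) = lowPos j :=
  simpleSwap_of_ne h.ne.1.symm h.ne.2.2.1.symm

lemma IsFar.simpleSwap_highPos {i j : Fin (n - 1)} (h : IsFar i j) :
    simpleSwap i (highPos j) = highPos j :=
  simpleSwap_of_ne h.ne.2.1.symm h.ne.2.2.2.symm

lemma IsFar.simpleSwap_lt_lowPos_iff {i j : Fin (n - 1)} (h : IsFar i j) (x : Fin n) :
    simpleSwap i x < lowPos j ↔ x < lowPos j := by
  have := isFar_iff.1 h
  simp only [simpleSwap_eq, Equiv.swap_apply_def, Fin.ext_iff, Fin.lt_def, val_lowPos,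
    val_highPos]
  split_ifs <;> simp <;> omega

lemma crossesLeft_cons_cons {a b c : Fin n} {i j : Fin (n - 1)} (h : IsFar i j)
    (v : Equiv.Perm (Fin n)) (T : SimpleWord n) :
    CrossesLeft a b c v (i :: j :: T) ↔ CrossesLeft a b c v (j :: i :: T) := by
  have hne := h.ne
  simp only [CrossesLeft, Equiv.Perm.mul_apply, h.simpleSwap_lowPos, h.simpleSwap_highPos,
    h.symm.simpleSwap_lowPos, h.symm.simpleSwap_highPos, symm_mul_simpleSwap,
    h.simpleSwap_lt_lowPos_iff, h.symm.simpleSwap_lt_lowPos_iff, mul_assoc, h.simpleSwap_mul]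
  have : ¬ ((v (lowPos i) = a ∧ v (highPos i) = c) ∧ (v (lowPos j) = a ∧ v (highPos j) = c)) := by
    rintro ⟨⟨h₁, -⟩, h₂, -⟩
    exact hne.1 (v.injective (h₁.trans h₂.symm))
  split_ifs <;> first | rfl | tauto

lemma isAscending_cons_cons {i j : Fin (n - 1)} (h : IsFar i j)
    (v : Equiv.Perm (Fin n)) (T : SimpleWord n) :
    IsAscending v (i :: j :: T) ↔ IsAscending v (j :: i :: T) := by
  simp only [IsAscending, Equiv.Perm.mul_apply, h.simpleSwap_lowPos, h.simpleSwap_highPos,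
    h.symm.simpleSwap_lowPos, h.symm.simpleSwap_highPos, mul_assoc, h.simpleSwap_mul]
  tauto

lemma sameCommutationClass_cons {R T : SimpleWord n} (i : Fin (n - 1))
    (h : SameCommutationClass R T) : SameCommutationClass (i :: R) (i :: T) := by
  induction h with
  | refl => exact Relation.ReflTransGen.refl
  | tail _ hmove ih =>
    obtain ⟨T₁, T₂, j, k, hjk, rfl, rfl⟩ := hmove
    exact ih.tail ⟨i :: T₁, T₂, j, k, hjk, by simp, by simp⟩

/-- Besides the commutation class itself, everything used in the induction over words is invariant
under these moves. -/
lemma move_to_front {i : Fin (n - 1)} (Q : SimpleWord n) : ∀ P : SimpleWord n,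
    (∀ p ∈ P, IsFar p i) →
      SameCommutationClass (P ++ i :: Q) (i :: (P ++ Q)) ∧
      wordPerm (P ++ i :: Q) = wordPerm (i :: (P ++ Q)) ∧
      (∀ v, IsAscending v (P ++ i :: Q) ↔ IsAscending v (i :: (P ++ Q))) ∧
      ∀ a b c v, CrossesLeft a b c v (P ++ i :: Q) ↔ CrossesLeft a b c v (i :: (P ++ Q))
  | [], _ => ⟨Relation.ReflTransGen.refl, rfl, fun _ => Iff.rfl, fun _ _ _ _ => Iff.rfl⟩
  | p :: P, hP => by
    obtain ⟨h₁, h₂, h₃, h₄⟩ := move_to_front Q P fun x hx => hP x (List.mem_cons_of_mem _ hx)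
    have hp : IsFar p i := hP p List.mem_cons_self
    refine ⟨?_, ?_, fun v => ?_, fun a b c v => ?_⟩
    · refine (sameCommutationClass_cons p h₁).trans (Relation.ReflTransGen.single ?_)
      exact ⟨[], P ++ Q, p, i, hp, rfl, rfl⟩
    · rw [List.cons_append, wordPerm_cons, h₂]
      simp only [List.cons_append, wordPerm_cons, ← mul_assoc, hp.simpleSwap_mul]
    · rw [List.cons_append, ← List.cons_append, List.cons_append, List.cons_append,
        ← isAscending_cons_cons hp]
      simp only [IsAscending, h₃]
    · rw [List.cons_append, List.cons_append, ← crossesLeft_cons_cons hp]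
      conv_lhs => rw [CrossesLeft, h₄]
      conv_rhs => rw [CrossesLeft]

/-- The two conditions on `CrossesLeft` are those forced when some word starts with `i`. They
exclude `i - 1` and `i + 1` respectively as the first letter not far from `i`. -/
lemma exists_eq_append_cons {i : Fin (n - 1)} : ∀ (R : SimpleWord n) (v : Equiv.Perm (Fin n)),
    IsAscending v R → v * wordPerm R = longestPerm n → v (lowPos i) < v (highPos i) →
    (∀ g < v (lowPos i), ¬ CrossesLeft g (v (lowPos i)) (v (highPos i)) v R) →
    (∀ g, v (highPos i) < g → highPos i < v.symm g →
      CrossesLeft (v (lowPos i)) (v (highPos i)) g v R) →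
    ∃ P Q : SimpleWord n, R = P ++ i :: Q ∧ ∀ p ∈ P, IsFar p i
  | [], v, _, hw, hi, _, _ => by
    simp only [wordPerm, List.map_nil, List.prod_nil, mul_one] at hw
    subst hw
    simp only [longestPerm, Fin.revPerm_apply, Fin.rev_lt_rev] at hi
    exact absurd hi (lowPos_lt_highPos i).not_gt
  | p :: R, v, hasc, hw, hi, h₁, h₂ => by
    by_cases hpi : p = i
    · exact ⟨[], R, by simp [hpi], by simp⟩
    rw [wordPerm_cons, ← mul_assoc] at hw
    have hpi' : (p : ℕ) ≠ i := fun h => hpi (Fin.ext h)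
    have hlh := lowPos_lt_highPos i
    by_cases hfar : IsFar p i
    · have e₁ : (v * simpleSwap p) (lowPos i) = v (lowPos i) := by
        simp [hfar.simpleSwap_lowPos]
      have e₂ : (v * simpleSwap p) (highPos i) = v (highPos i) := by
        simp [hfar.simpleSwap_highPos]
      have hne := hfar.ne
      obtain ⟨P, Q, rfl, hP⟩ := exists_eq_append_cons (i := i) R (v * simpleSwap p) hasc.2 hw
        (by rwa [e₁, e₂]) (by
          rw [e₁, e₂]
          intro g hg
          have := h₁ g hg
          rwa [CrossesLeft, if_neg] at this
          rintro ⟨-, h⟩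
          exact hne.2.2.2 (v.injective h)) (by
          rw [e₁, e₂]
          intro g hg hgi
          have := h₂ g hg (by
            rw [symm_mul_simpleSwap] at hgi
            have hf := isFar_iff.1 hfar
            revert hgi
            simp only [simpleSwap_eq, Equiv.swap_apply_def, Fin.ext_iff, Fin.lt_def, val_lowPos,
              val_highPos]
            split_ifs <;> simp <;> omega)
          rwa [CrossesLeft, if_neg] at this
          rintro ⟨h, -⟩
          exact hne.1 (v.injective h))
      exact ⟨p :: P, Q, rfl, by simpa using ⟨hfar, hP⟩⟩
    exfalso
    rw [isFar_iff] at hfar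
    have hasc₁ := hasc.1
    -- If `p = i - 1`, the strand at `lowPos i` passes left of the one at `lowPos p`, and so lies
    -- left of the latter's crossing with `v (highPos i)`. If `p = i + 1`, the strand from `highPos
    -- p` passes left of `v (highPos i)`, which then lies right of its crossing with `v (lowPos i)`.
    rcases Nat.lt_or_gt_of_ne hpi' with hlt | hgt
    · have hp : highPos p = lowPos i := by ext; simp; omega
      rw [hp] at hasc₁
      have hli : lowPos p < lowPos i := by rw [← hp]; exact lowPos_lt_highPos p
      refine h₁ _ hasc₁ ?_
      rw [CrossesLeft, if_neg (by
        rintro ⟨-, h⟩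
        rw [hp] at h
        exact hi.ne h)]
      refine crossesLeft_of_symm_lt hasc₁ hi R _ hasc.2 hw ?_ ?_
      · rw [symm_mul_simpleSwap, symm_mul_simpleSwap, ← hp]
        simpa using lowPos_lt_highPos p
      · rw [symm_mul_simpleSwap, symm_mul_simpleSwap]
        simp only [Equiv.symm_apply_apply, simpleSwap_lowPos]
        rw [simpleSwap_of_ne (hli.trans hlh).ne' (by rw [hp]; exact hlh.ne'), hp]
        exact hlh
    · have hp : lowPos p = highPos i := by ext; simp; omega
      rw [hp] at hasc₁
      have hli : highPos i < highPos p := by rw [← hp]; exact lowPos_lt_highPos p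
      have := h₂ _ hasc₁ (by simpa using hli)
      rw [CrossesLeft, if_neg (by
        rintro ⟨h, -⟩
        rw [hp] at h
        exact hi.ne' h)] at this
      refine not_crossesLeft_of_symm_lt_middle hasc₁ R _ hasc.2 ?_ this
      rw [symm_mul_simpleSwap, symm_mul_simpleSwap, ← hp]
      simpa using lowPos_lt_highPos p

lemma sameCommutationClass_of_crossesLeft_iff : ∀ (R T : SimpleWord n) (v : Equiv.Perm (Fin n)),
    IsAscending v R → v * wordPerm R = longestPerm n →
    IsAscending v T → v * wordPerm T = longestPerm n →
    (∀ a b c, a < b → b < c → (CrossesLeft a b c v R ↔ CrossesLeft a b c v T)) →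
    SameCommutationClass T R
  | [], [], _, _, _, _, _, _ => Relation.ReflTransGen.refl
  | [], p :: T, v, _, hw, hasc, _, _ => by
    simp only [wordPerm, List.map_nil, List.prod_nil, mul_one] at hw
    subst hw
    have := hasc.1
    simp only [longestPerm, Fin.revPerm_apply, Fin.rev_lt_rev] at this
    exact absurd this (lowPos_lt_highPos p).not_gt
  | i :: R, T, v, hR, hRw, hT, hTw, h => by
    rw [wordPerm_cons, ← mul_assoc] at hRw
    have hi := hR.1
    have hinv : (v * simpleSwap i).symm (v (highPos i)) <
        (v * simpleSwap i).symm (v (lowPos i)) := by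
      rw [symm_mul_simpleSwap, symm_mul_simpleSwap]
      simpa using lowPos_lt_highPos i
    obtain ⟨P, Q, rfl, hP⟩ := exists_eq_append_cons (i := i) T v hT hTw hi (by
        intro g hg
        rw [← h _ _ _ hg hi, CrossesLeft, if_neg (fun h => hg.ne' h.1)]
        exact not_crossesLeft_of_symm_lt_middle hi R _ hR.2 hinv) (by
        intro g hg hgi
        rw [← h _ _ _ hi hg, CrossesLeft, if_neg (fun h => hg.ne h.2)]
        refine crossesLeft_of_symm_lt hi hg R _ hR.2 hRw hinv ?_
        refine symm_lt_symm_mul_simpleSwap ?_ (fun h => hg.ne h.2)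
        simpa using (lowPos_lt_highPos i).trans hgi)
    obtain ⟨h₁, h₂, h₃, h₄⟩ := move_to_front Q P hP
    rw [h₃] at hT
    rw [h₂, wordPerm_cons, ← mul_assoc] at hTw
    refine h₁.trans (sameCommutationClass_cons i ?_)
    refine sameCommutationClass_of_crossesLeft_iff R (P ++ Q) (v * simpleSwap i) hR.2 hRw hT.2 hTw
      fun a b c hab hbc => ?_
    -- The crossing of `a` and `c` has just been used up, so neither remaining word contains it;
    -- every other triple is inherited.
    by_cases hp : v (lowPos i) = a ∧ v (highPos i) = c
    · obtain ⟨rfl, rfl⟩ := hp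
      exact iff_of_false (not_crossesLeft_of_symm_lt hi R _ hR.2 hinv)
        (not_crossesLeft_of_symm_lt hi _ _ hT.2 hinv)
    · have := h a b c hab hbc
      rwa [h₄, CrossesLeft, if_neg hp, CrossesLeft, if_neg hp] at this

/-! ### The counting polynomials -/

/-- The polynomial in `q` that counts the walks of flags along the word which start at a given
flag of the cell of `v` and end in the cell of `w`. -/
noncomputable def walkPoly : Equiv.Perm (Fin n) → SimpleWord n → Equiv.Perm (Fin n) → ℚ[X]
  | v, [], w => if v = w then 1 else 0
  | v, i :: R, w => X * walkPoly (stepUp v i) R w + walkPoly (stepDown v i) R w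

lemma coeff_walkPoly_of_length_lt (w : Equiv.Perm (Fin n)) : ∀ (R : SimpleWord n)
    (v : Equiv.Perm (Fin n)) (k : ℕ), R.length < k → (walkPoly v R w).coeff k = 0
  | [], v, k, hk => by
    have : k ≠ 0 := by simpa using hk.ne'
    rw [walkPoly]
    split_ifs <;> simp [coeff_one, this]
  | i :: R, v, 0, hk => by simp at hk
  | i :: R, v, k + 1, hk => by
    have hk' : R.length < k := by simpa using hk
    rw [walkPoly, coeff_add, coeff_X_mul, coeff_walkPoly_of_length_lt w R _ k hk',
      coeff_walkPoly_of_length_lt w R _ (k + 1) (by omega), add_zero]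

/-- Only the branch in which every step goes up reaches the degree `R.length`. -/
lemma coeff_length_walkPoly (w : Equiv.Perm (Fin n)) : ∀ (R : SimpleWord n)
    (v : Equiv.Perm (Fin n)),
    (walkPoly v R w).coeff R.length = if demazure v R = w then 1 else 0
  | [], v => by
    rw [walkPoly]
    split_ifs <;> simp_all [demazure]
  | i :: R, v => by
    rw [walkPoly, List.length_cons, coeff_add, coeff_X_mul, coeff_length_walkPoly w R,
      coeff_walkPoly_of_length_lt w R _ _ (Nat.lt_succ_self _), add_zero]
    rfl

/-- The factor `X` shifts the coefficient of degree `L - 1` to `L`, which avoids truncated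
subtraction for the empty word. -/
lemma coeff_length_X_mul_walkPoly (w : Equiv.Perm (Fin n)) : ∀ (R : SimpleWord n)
    (v : Equiv.Perm (Fin n)),
    (X * walkPoly v R w).coeff R.length = ((skipProducts v R).count w : ℚ)
  | [], v => by simp [skipProducts]
  | i :: R, v => by
    rw [walkPoly, List.length_cons, coeff_X_mul, coeff_add, coeff_length_X_mul_walkPoly w R,
      coeff_length_walkPoly, skipProducts, Multiset.count_cons]
    simp [eq_comm]

lemma sameCommutationClass_of_walkPoly_eq {R T : SimpleWord n}
    (hR : R ∈ reducedWords (longestPerm n)) (hT : T ∈ reducedWords (longestPerm n))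
    (h : ∀ w, walkPoly 1 R w = walkPoly 1 T w) : SameCommutationClass R T := by
  have hskip : skipProducts 1 R = skipProducts 1 T := by
    ext w
    have := coeff_length_X_mul_walkPoly w R 1
    rw [h, hR.2, ← hT.2, coeff_length_X_mul_walkPoly] at this
    exact_mod_cast this.symm
  have hRa := isAscending_of_mem_reducedWords hR
  have hTa := isAscending_of_mem_reducedWords hT
  have hRw : 1 * wordPerm R = longestPerm n := by rw [one_mul, hR.1]
  have hTw : 1 * wordPerm T = longestPerm n := by rw [one_mul, hT.1]
  refine sameCommutationClass_of_crossesLeft_iff T R 1 hTa hTw hRa hRw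
    fun a b c hab hbc => ?_
  classical
  have h₁ := countP_skipProducts hab hbc R 1 hRa hRw
  have h₂ := countP_skipProducts hab hbc T 1 hTa hTw
  rw [hskip, h₂] at h₁
  split_ifs at h₁ <;> simp_all

end CommutationClasses

/-! ### Schubert cells and adapted bases -/

section Flags

variable {n : ℕ} {K : Type} [Field K]

/-- The vector `b j` has its last nonzero coordinate at `w j`. -/
def IsAdapted (b : Fin n → Fin n → K) (w : Equiv.Perm (Fin n)) : Prop :=
  ∀ j, b j (w j) ≠ 0 ∧ ∀ x, w j < x → b j x = 0

/-- The last nonzero coordinates are distinct, so the largest one occurring in a combination cannot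
cancel. -/
lemma IsAdapted.exists_pivot {b : Fin n → Fin n → K} {w : Equiv.Perm (Fin n)}
    (hb : IsAdapted b w) {c : Fin n → K} (hc : c ≠ 0) :
    ∃ j, c j ≠ 0 ∧ (∑ l, c l • b l) (w j) ≠ 0 ∧ ∀ x, w j < x → (∑ l, c l • b l) x = 0 := by
  classical
  obtain ⟨j₀, hj₀⟩ := Function.ne_iff.1 hc
  obtain ⟨j, hj, hmax⟩ := Finset.exists_max_image (Finset.univ.filter fun l => c l ≠ 0) w
    ⟨j₀, by simpa using hj₀⟩
  have hj' : c j ≠ 0 := by simpa using hj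
  have hmax' : ∀ l, c l ≠ 0 → w l ≤ w j := fun l hl => hmax l (by simpa using hl)
  refine ⟨j, hj', ?_, fun x hx => ?_⟩
  · rw [Finset.sum_apply, Finset.sum_eq_single j]
    · exact mul_ne_zero hj' (hb j).1
    · intro l _ hl
      by_cases hcl : c l = 0
      · simp [hcl]
      · simp [(hb l).2 _ (lt_of_le_of_ne (hmax' l hcl) (w.injective.ne hl))]
    · simp
  · rw [Finset.sum_apply]
    refine Finset.sum_eq_zero fun l _ => ?_
    by_cases hcl : c l = 0
    · simp [hcl]
    · simp [(hb l).2 x ((hmax' l hcl).trans_lt hx)]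

lemma IsAdapted.linearIndependent {b : Fin n → Fin n → K} {w : Equiv.Perm (Fin n)}
    (hb : IsAdapted b w) : LinearIndependent K b := by
  rw [Fintype.linearIndependent_iff]
  intro c hc
  by_contra! hcon
  obtain ⟨j, hj⟩ := hcon
  obtain ⟨l, -, hl, -⟩ := hb.exists_pivot (c := c) (fun h => hj (congrFun h j))
  exact hl (by rw [hc]; rfl)

lemma IsAdapted.exists_apply_eq_of_mem_span {b : Fin n → Fin n → K} {w : Equiv.Perm (Fin n)}
    (hb : IsAdapted b w) {J : Set (Fin n)} {y : Fin n → K} (hy : y ∈ Submodule.span K (b '' J))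
    {x : Fin n} (hx : y x ≠ 0) (hx' : ∀ z, x < z → y z = 0) : ∃ j ∈ J, w j = x := by
  rw [Finsupp.mem_span_image_iff_linearCombination] at hy
  obtain ⟨c, hcJ, rfl⟩ := hy
  rw [Finsupp.linearCombination_apply, Finsupp.sum_fintype _ _ (by simp)] at hx hx'
  have hc : (c : Fin n → K) ≠ 0 := by
    rintro h
    simp [h] at hx
  obtain ⟨j, hj, h₁, h₂⟩ := hb.exists_pivot hc
  refine ⟨j, ?_, ?_⟩
  · exact (Finsupp.mem_supported K c).1 hcJ (by simpa using hj)
  · rcases lt_trichotomy (w j) x with h | h | h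
    · exact absurd (h₂ x h) hx
    · exact h
    · exact absurd (hx' _ h) h₁

/-- The span of the first `k` vectors of a family. -/
def initialSpan (b : Fin n → Fin n → K) (k : ℕ) : Submodule K (Fin n → K) :=
  Submodule.span K (b '' {j | (j : ℕ) < k})

lemma mem_initialSpan (b : Fin n → Fin n → K) {k : ℕ} {j : Fin n} (h : (j : ℕ) < k) :
    b j ∈ initialSpan b k :=
  Submodule.subset_span ⟨j, h, rfl⟩

lemma initialSpan_le_iff {b : Fin n → Fin n → K} {k : ℕ} {V : Submodule K (Fin n → K)} :
    initialSpan b k ≤ V ↔ ∀ j : Fin n, (j : ℕ) < k → b j ∈ V := by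
  simp [initialSpan, Submodule.span_le, Set.subset_def]

/-- The vectors of an adapted basis are the columns of an invertible upper triangular matrix,
reordered by `w`. -/
lemma mem_schubertCell_iff {F : CompleteFlag n K} {w : Equiv.Perm (Fin n)} :
    F ∈ schubertCell K w ↔
      ∃ b : Fin n → Fin n → K, IsAdapted b w ∧ ∀ k, F.space k = initialSpan b k := by
  have hmap : ∀ (M : Matrix (Fin n) (Fin n) K) (k : Fin (n + 1)),
      (coordSubspace K w k).map M.mulVecLin = initialSpan (fun j => M.col (w j)) k := by
    intro M k
    rw [coordSubspace, Submodule.map_span, initialSpan]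
    congr 1
    ext y
    constructor
    · rintro ⟨_, ⟨j, hj, rfl⟩, rfl⟩
      exact ⟨j, hj, by simp⟩
    · rintro ⟨j, hj, rfl⟩
      exact ⟨_, ⟨j, hj, rfl⟩, by simp⟩
  constructor
  · rintro ⟨M, hM, hF⟩
    refine ⟨fun j => (M : Matrix (Fin n) (Fin n) K).col (w j), fun j => ⟨?_, fun x hx => ?_⟩,
      fun k => by rw [hF, hmap]⟩
    · have hdet : (M : Matrix (Fin n) (Fin n) K).det ≠ 0 :=
        ((Matrix.isUnit_iff_isUnit_det _).1 M.isUnit).ne_zero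
      rw [Matrix.det_of_isUpperTriangular hM, Finset.prod_ne_zero_iff] at hdet
      exact hdet (w j) (Finset.mem_univ _)
    · exact hM hx
  · rintro ⟨b, hb, hF⟩
    let M : Matrix (Fin n) (Fin n) K := Matrix.of fun x y => b (w.symm y) x
    have hM : M.BlockTriangular id := by
      intro x y hxy
      exact (hb (w.symm y)).2 x (by simpa using hxy)
    have hdet : IsUnit M.det := by
      rw [Matrix.det_of_isUpperTriangular hM, isUnit_iff_ne_zero, Finset.prod_ne_zero_iff]
      intro x _
      simpa [M] using (hb (w.symm x)).1
    refine ⟨Matrix.GeneralLinearGroup.mk'' M hdet, hM, fun k => ?_⟩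
    rw [hF, hmap]
    congr 1
    ext j x
    change b j x = b (w.symm (w j)) x
    simp

lemma eq_one_of_forall_apply_le {σ : Equiv.Perm (Fin n)} (h : ∀ j, σ j ≤ j) : σ = 1 := by
  have key : ∀ (m : ℕ) (j : Fin n), (j : ℕ) = m → σ j = j := by
    intro m
    induction m using Nat.strong_induction_on with
    | _ m ih =>
      intro j hj
      by_contra hne
      have hlt : σ j < j := lt_of_le_of_ne (h j) hne
      exact hne (σ.injective (ih _ (by rw [← hj]; exact hlt) (σ j) rfl))
  ext j
  simp [key _ j rfl]

/-- Comparing last nonzero coordinates in each space of the flag gives `w⁻¹ u j ≤ j` for all `j`,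
which forces `w⁻¹ u = 1`. -/
lemma eq_of_mem_schubertCell {F : CompleteFlag n K} {u w : Equiv.Perm (Fin n)}
    (hu : F ∈ schubertCell K u) (hw : F ∈ schubertCell K w) : u = w := by
  obtain ⟨b, hb, hFb⟩ := mem_schubertCell_iff.1 hu
  obtain ⟨b', hb', hFb'⟩ := mem_schubertCell_iff.1 hw
  have : w⁻¹ * u = 1 := by
    refine eq_one_of_forall_apply_le fun j => ?_
    have hmem : b j ∈ initialSpan b' (j.succ : Fin (n + 1)) := by
      rw [← hFb', hFb]
      exact mem_initialSpan b (by simp)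
    obtain ⟨l, hl, hlj⟩ := hb'.exists_apply_eq_of_mem_span hmem (hb j).1 (hb j).2
    have : (w⁻¹ * u) j = l := by
      rw [Equiv.Perm.mul_apply, ← hlj]
      exact w.symm_apply_apply l
    rw [this, Fin.le_def]
    simpa [Nat.lt_succ_iff] using hl
  exact (inv_mul_eq_one.1 this).symm

/-- The flag spanned by an adapted family. -/
def adaptedFlag {b : Fin n → Fin n → K} {w : Equiv.Perm (Fin n)} (hb : IsAdapted b w) :
    CompleteFlag n K where
  space k := initialSpan b k
  mono k l hkl := initialSpan_le_iff.2 fun j hj =>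
    mem_initialSpan b (hj.trans_le (Fin.le_def.1 hkl))
  finrank_space k := by
    have hli := hb.linearIndependent.comp (Subtype.val : {j : Fin n // (j : ℕ) < k} → Fin n)
      Subtype.val_injective
    have := finrank_span_eq_card hli
    rw [Set.range_comp, Subtype.range_coe_subtype,
      Fintype.card_fin_lt_of_le (Nat.lt_succ_iff.1 k.2)] at this
    exact this

lemma adaptedFlag_mem_schubertCell {b : Fin n → Fin n → K} {w : Equiv.Perm (Fin n)}
    (hb : IsAdapted b w) : adaptedFlag hb ∈ schubertCell K w :=
  mem_schubertCell_iff.2 ⟨b, hb, fun _ => rfl⟩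

/-! ### Adjacent flags -/

/-- The two flags agree outside the dimension belonging to the letter `i`. -/
def IsAdjacent (i : Fin (n - 1)) (F G : CompleteFlag n K) : Prop :=
  ∀ k : Fin (n + 1), (k : ℕ) ≠ (i : ℕ) + 1 → F.space k = G.space k

lemma IsAdjacent.symm {i : Fin (n - 1)} {F G : CompleteFlag n K} (h : IsAdjacent i F G) :
    IsAdjacent i G F := fun k hk => (h k hk).symm

lemma IsAdjacent.trans {i : Fin (n - 1)} {F G H : CompleteFlag n K} (h : IsAdjacent i F G)
    (h' : IsAdjacent i G H) : IsAdjacent i F H := fun k hk => (h k hk).trans (h' k hk)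

lemma initialSpan_le_initialSpan {b b' : Fin n → Fin n → K} {i : Fin (n - 1)}
    (h : ∀ j, j ≠ lowPos i → j ≠ highPos i → b' j = b j)
    (hl : b' (lowPos i) ∈ Submodule.span K {b (lowPos i), b (highPos i)})
    (hh : b' (highPos i) ∈ Submodule.span K {b (lowPos i), b (highPos i)})
    {k : ℕ} (hk : k ≠ (i : ℕ) + 1) : initialSpan b' k ≤ initialSpan b k := by
  rw [initialSpan_le_iff]
  intro j hj
  have hpair : (i : ℕ) < k →
      Submodule.span K {b (lowPos i), b (highPos i)} ≤ initialSpan b k := by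
    intro hik
    rw [Submodule.span_le, Set.pair_subset_iff]
    exact ⟨mem_initialSpan b hik, mem_initialSpan b (by simp; omega)⟩
  by_cases c₁ : j = lowPos i
  · subst c₁
    exact hpair hj hl
  by_cases c₂ : j = highPos i
  · subst c₂
    exact hpair (by simp at hj; omega) hh
  · rw [h j c₁ c₂]
    exact mem_initialSpan b hj

lemma exists_isAdjacent_stepDown {F : CompleteFlag n K} {v : Equiv.Perm (Fin n)}
    (hF : F ∈ schubertCell K v) (i : Fin (n - 1)) :
    ∃ G ∈ schubertCell K (stepDown v i), IsAdjacent i F G := by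
  unfold stepDown
  split_ifs with h
  · exact ⟨F, hF, fun _ _ => rfl⟩
  obtain ⟨b, hb, hFb⟩ := mem_schubertCell_iff.1 hF
  have hb' : IsAdapted (fun j => b (simpleSwap i j)) (v * simpleSwap i) := fun j =>
    hb (simpleSwap i j)
  refine ⟨adaptedFlag hb', adaptedFlag_mem_schubertCell hb', fun k hk => ?_⟩
  rw [hFb]
  apply le_antisymm
  · refine initialSpan_le_initialSpan (i := i) (fun j h₁ h₂ => ?_) ?_ ?_ hk
    · simp [simpleSwap_of_ne h₁ h₂]
    · exact Submodule.subset_span (by simp)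
    · exact Submodule.subset_span (by simp)
  · refine initialSpan_le_initialSpan (i := i) (fun j h₁ h₂ => ?_) ?_ ?_ hk
    · simp [simpleSwap_of_ne h₁ h₂]
    · exact Submodule.subset_span (by simp)
    · exact Submodule.subset_span (by simp)

/-- The dimension in which the flags adjacent with respect to `i` differ. -/
def midDim (i : Fin (n - 1)) : Fin (n + 1) := ⟨i + 1, by omega⟩

lemma IsAdjacent.eq_of_le {i : Fin (n - 1)} {F G : CompleteFlag n K} (h : IsAdjacent i F G)
    (hle : F.space (midDim i) ≤ G.space (midDim i)) : F = G := by
  ext1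
  funext k
  by_cases hk : (k : ℕ) = i + 1
  · obtain rfl : k = midDim i := Fin.ext hk
    exact Submodule.eq_of_le_of_finrank_eq hle (by rw [F.finrank_space, G.finrank_space])
  · exact h k hk

/-- The family `b` with the vectors at the two positions of the letter `i` replaced by
`b_{i+1} + t b_i` and `b_i`. -/
def pencil (b : Fin n → Fin n → K) (i : Fin (n - 1)) (t : K) : Fin n → Fin n → K := fun j =>
  if j = lowPos i then b (highPos i) + t • b (lowPos i)
  else if j = highPos i then b (lowPos i) else b j

lemma pencil_lowPos (b : Fin n → Fin n → K) (i : Fin (n - 1)) (t : K) :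
    pencil b i t (lowPos i) = b (highPos i) + t • b (lowPos i) := by
  simp [pencil]

lemma pencil_highPos (b : Fin n → Fin n → K) (i : Fin (n - 1)) (t : K) :
    pencil b i t (highPos i) = b (lowPos i) := by
  simp [pencil, (lowPos_lt_highPos i).ne']

lemma pencil_of_ne (b : Fin n → Fin n → K) {i : Fin (n - 1)} (t : K) {j : Fin n}
    (h₁ : j ≠ lowPos i) (h₂ : j ≠ highPos i) : pencil b i t j = b j := by
  simp [pencil, h₁, h₂]

lemma IsAdapted.pencil {b : Fin n → Fin n → K} {u : Equiv.Perm (Fin n)} (hb : IsAdapted b u)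
    {i : Fin (n - 1)} (hu : u (lowPos i) < u (highPos i)) (t : K) :
    IsAdapted (pencil b i t) (u * simpleSwap i) := by
  intro j
  by_cases h₁ : j = lowPos i
  · subst h₁
    rw [pencil_lowPos, Equiv.Perm.mul_apply, simpleSwap_lowPos]
    refine ⟨?_, fun x hx => ?_⟩
    · simpa [(hb (lowPos i)).2 _ hu] using (hb (highPos i)).1
    · simp [(hb (lowPos i)).2 _ (hu.trans hx), (hb (highPos i)).2 _ hx]
  by_cases h₂ : j = highPos i
  · subst h₂
    rw [pencil_highPos, Equiv.Perm.mul_apply, simpleSwap_highPos]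
    exact hb (lowPos i)
  · rw [pencil_of_ne b t h₁ h₂, Equiv.Perm.mul_apply, simpleSwap_of_ne h₁ h₂]
    exact hb j

lemma initialSpan_pencil (b : Fin n → Fin n → K) (i : Fin (n - 1)) (t : K) {k : ℕ}
    (hk : k ≠ (i : ℕ) + 1) : initialSpan b k = initialSpan (pencil b i t) k := by
  apply le_antisymm
  · refine initialSpan_le_initialSpan (i := i) (fun j h₁ h₂ => (pencil_of_ne b t h₁ h₂).symm)
      ?_ ?_ hk
    · rw [← pencil_highPos b i t]
      exact Submodule.subset_span (by simp)
    · have : b (highPos i) = pencil b i t (lowPos i) - t • pencil b i t (highPos i) := by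
        rw [pencil_lowPos, pencil_highPos, add_sub_cancel_right]
      rw [this]
      exact Submodule.sub_mem _ (Submodule.subset_span (by simp))
        (Submodule.smul_mem _ _ (Submodule.subset_span (by simp)))
  · refine initialSpan_le_initialSpan (i := i) (fun j h₁ h₂ => pencil_of_ne b t h₁ h₂) ?_ ?_ hk
    · rw [pencil_lowPos]
      exact Submodule.add_mem _ (Submodule.subset_span (by simp))
        (Submodule.smul_mem _ _ (Submodule.subset_span (by simp)))
    · rw [pencil_highPos]
      exact Submodule.subset_span (by simp)

/-! ### The middle space of an adjacent flag -/

section Pencil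

variable {b : Fin n → Fin n → K} {F G : CompleteFlag n K} {i : Fin (n - 1)}

lemma mem_space_midDim_of_lt (hFb : ∀ k, F.space k = initialSpan b k) (hG : IsAdjacent i F G)
    {j : Fin n} (hj : j < lowPos i) : b j ∈ G.space (midDim i) := by
  let k : Fin (n + 1) := ⟨i, by omega⟩
  have hk : k ≤ midDim i := by simp [k, midDim]
  refine G.mono hk ?_
  rw [← hG k (by simp [k]), hFb]
  exact mem_initialSpan b hj

/-- Otherwise the space of dimension `i + 1` would contain the one of dimension `i + 2`. -/
lemma highPos_notMem_of_lowPos_mem (hFb : ∀ k, F.space k = initialSpan b k)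
    (hG : IsAdjacent i F G) (hl : b (lowPos i) ∈ G.space (midDim i)) :
    b (highPos i) ∉ G.space (midDim i) := by
  intro hh
  let k : Fin (n + 1) := ⟨i + 2, by omega⟩
  have hle : G.space k ≤ G.space (midDim i) := by
    rw [← hG k (by simp [k]), hFb, initialSpan_le_iff]
    intro j hj
    by_cases h₁ : j = lowPos i
    · rwa [h₁]
    by_cases h₂ : j = highPos i
    · rwa [h₂]
    · refine mem_space_midDim_of_lt hFb hG ?_
      simp only [Fin.ext_iff, val_lowPos, val_highPos] at h₁ h₂
      simp only [k] at hj
      simp only [Fin.lt_def, val_lowPos]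
      omega
  have := Submodule.finrank_mono hle
  rw [G.finrank_space, G.finrank_space] at this
  simp [k, midDim] at this

lemma exists_mem_space_midDim (hFb : ∀ k, F.space k = initialSpan b k)
    (hG : IsAdjacent i F G) :
    b (lowPos i) ∈ G.space (midDim i) ∨
      ∃ t : K, b (highPos i) + t • b (lowPos i) ∈ G.space (midDim i) := by
  let k₀ : Fin (n + 1) := ⟨i, by omega⟩
  let k₂ : Fin (n + 1) := ⟨i + 2, by omega⟩
  have hk₀ : k₀ ≤ midDim i := by simp [k₀, midDim]
  have hk₂ : midDim i ≤ k₂ := by simp [k₂, midDim]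
  have hlt : G.space k₀ < G.space (midDim i) := by
    refine lt_of_le_of_ne (G.mono hk₀) fun h => ?_
    have := G.finrank_space (midDim i)
    rw [← h, G.finrank_space] at this
    simp [k₀, midDim] at this
  obtain ⟨y, hy, hy₀⟩ := SetLike.exists_of_lt hlt
  have hset : {j : Fin n | (j : ℕ) < k₂} =
      insert (highPos i) (insert (lowPos i) {j : Fin n | (j : ℕ) < k₀}) := by
    ext j
    simp only [k₂, k₀, Set.mem_ofPred_eq, Set.mem_insert_iff, Fin.ext_iff, val_lowPos, val_highPos]
    omega
  have hy₂ := G.mono hk₂ hy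
  rw [← hG k₂ (by simp [k₂]), hFb, initialSpan, hset, Set.image_insert_eq, Set.image_insert_eq,
    Submodule.mem_span_insert] at hy₂
  obtain ⟨β, y', hy', rfl⟩ := hy₂
  obtain ⟨α, z, hz, rfl⟩ := Submodule.mem_span_insert.1 hy'
  have hz₀ : z ∈ G.space k₀ := by
    rw [← hG k₀ (by simp [k₀]), hFb]; exact hz
  have hmem : β • b (highPos i) + α • b (lowPos i) ∈ G.space (midDim i) := by
    have := Submodule.sub_mem _ hy (G.mono hk₀ hz₀)
    rwa [← add_assoc, add_sub_cancel_right] at this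
  by_cases hβ : β = 0
  · left
    subst hβ
    rw [zero_smul, zero_add] at hmem
    have hα : α ≠ 0 := by
      rintro rfl
      simp only [zero_smul, zero_add] at hy₀
      exact hy₀ hz₀
    have := Submodule.smul_mem _ α⁻¹ hmem
    rwa [smul_smul, inv_mul_cancel₀ hα, one_smul] at this
  · right
    refine ⟨β⁻¹ * α, ?_⟩
    have := Submodule.smul_mem _ β⁻¹ hmem
    rwa [smul_add, smul_smul, smul_smul, inv_mul_cancel₀ hβ, one_smul] at this

end Pencil

/-- The adjacent flags form a projective line. The point at infinity `none` is `F`, and `some t` is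
spanned by the pencil basis, whose last nonzero coordinates are those of `u` exchanged by `s_i`. -/
lemma exists_equiv_isAdjacent_of_lt {F : CompleteFlag n K} {u : Equiv.Perm (Fin n)}
    (hF : F ∈ schubertCell K u) {i : Fin (n - 1)} (hu : u (lowPos i) < u (highPos i)) :
    ∃ e : Option K ≃ {G : CompleteFlag n K // IsAdjacent i F G},
      (e none : CompleteFlag n K) ∈ schubertCell K u ∧
        ∀ t, (e (some t) : CompleteFlag n K) ∈ schubertCell K (u * simpleSwap i) := by
  obtain ⟨b, hb, hFb⟩ := mem_schubertCell_iff.1 hF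
  have hadj : ∀ t, IsAdjacent i F (adaptedFlag (hb.pencil hu t)) := fun t k hk => by
    rw [hFb]; exact initialSpan_pencil b i t hk
  have hpen : ∀ t, b (highPos i) + t • b (lowPos i) ∈
      (adaptedFlag (hb.pencil hu t)).space (midDim i) := fun t => by
    rw [← pencil_lowPos b i t]
    exact mem_initialSpan _ (by simp [midDim])
  have hlow : b (lowPos i) ∈ F.space (midDim i) := by
    rw [hFb]
    exact mem_initialSpan _ (by simp [midDim])
  let f : Option K → {G : CompleteFlag n K // IsAdjacent i F G}
    | none => ⟨F, fun _ _ => rfl⟩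
    | some t => ⟨adaptedFlag (hb.pencil hu t), hadj t⟩
  have hne : ∀ t, F ≠ adaptedFlag (hb.pencil hu t) := by
    intro t h
    have h₁ := hpen t
    rw [← h] at h₁
    have h₂ := Submodule.sub_mem _ h₁ (Submodule.smul_mem _ t hlow)
    rw [add_sub_cancel_right] at h₂
    exact highPos_notMem_of_lowPos_mem hFb (fun _ _ => rfl) hlow h₂
  have hinj : Function.Injective f := by
    rintro (_ | s) (_ | t) h
    · rfl
    · exact absurd (congrArg Subtype.val h) (hne t)
    · exact absurd (congrArg Subtype.val h).symm (hne s)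
    · by_contra hst
      have hst' : s - t ≠ 0 := sub_ne_zero.2 fun h => hst (congrArg some h)
      have h' : adaptedFlag (hb.pencil hu s) = adaptedFlag (hb.pencil hu t) :=
        congrArg Subtype.val h
      have h₁ := hpen s
      rw [h'] at h₁
      have h₂ := Submodule.sub_mem _ h₁ (hpen t)
      rw [add_sub_add_left_eq_sub, ← sub_smul] at h₂
      have h₃ := Submodule.smul_mem _ (s - t)⁻¹ h₂
      rw [smul_smul, inv_mul_cancel₀ hst', one_smul] at h₃
      have h₄ := Submodule.sub_mem _ (hpen t) (Submodule.smul_mem _ t h₃)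
      rw [add_sub_cancel_right] at h₄
      exact highPos_notMem_of_lowPos_mem hFb (hadj t) h₃ h₄
  have hsurj : Function.Surjective f := by
    rintro ⟨G, hG⟩
    rcases exists_mem_space_midDim hFb hG with h | ⟨t, h⟩
    · refine ⟨none, Subtype.ext (hG.eq_of_le ?_)⟩
      rw [hFb, initialSpan_le_iff]
      intro j hj
      by_cases h₁ : j = lowPos i
      · rwa [h₁]
      · refine mem_space_midDim_of_lt hFb hG (lt_of_le_of_ne ?_ h₁)
        simp only [midDim] at hj
        simp only [Fin.le_def, val_lowPos]; omega
    · refine ⟨some t, Subtype.ext (((hadj t).symm.trans hG).eq_of_le ?_)⟩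
      refine initialSpan_le_iff.2 fun j hj => ?_
      simp only [midDim] at hj
      by_cases h₁ : j = lowPos i
      · rwa [h₁, pencil_lowPos]
      · have h₂ : j < lowPos i := lt_of_le_of_ne (by simp only [Fin.le_def, val_lowPos]; omega) h₁
        rw [pencil_of_ne b t h₁ (h₂.trans (lowPos_lt_highPos i)).ne]
        exact mem_space_midDim_of_lt hFb hG h₂
  exact ⟨Equiv.ofBijective f ⟨hinj, hsurj⟩, hF, fun t =>
    adaptedFlag_mem_schubertCell (hb.pencil hu t)⟩

lemma exists_equiv_isAdjacent {F : CompleteFlag n K} {v : Equiv.Perm (Fin n)}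
    (hF : F ∈ schubertCell K v) (i : Fin (n - 1)) :
    ∃ e : Option K ≃ {G : CompleteFlag n K // IsAdjacent i F G},
      (e none : CompleteFlag n K) ∈ schubertCell K (stepDown v i) ∧
        ∀ t, (e (some t) : CompleteFlag n K) ∈ schubertCell K (stepUp v i) := by
  obtain ⟨F', hF', hadj⟩ := exists_isAdjacent_stepDown hF i
  have hasc : stepDown v i (lowPos i) < stepDown v i (highPos i) := by
    unfold stepDown
    split_ifs with h
    · exact h
    · have : v (highPos i) ≠ v (lowPos i) := v.injective.ne (lowPos_lt_highPos i).ne'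
      simpa using lt_of_le_of_ne (not_lt.1 h) this
  have hup : stepDown v i * simpleSwap i = stepUp v i := by
    unfold stepDown stepUp
    split_ifs with h
    · rfl
    · rw [mul_assoc, simpleSwap_mul_self, mul_one]
  -- Adjacency is an equivalence relation, so the neighbours of `F` are those of the flag `F'` in
  -- the smaller cell.
  obtain ⟨e, h₁, h₂⟩ := exists_equiv_isAdjacent_of_lt hF' hasc
  rw [hup] at h₂
  exact ⟨e.trans (Equiv.subtypeEquivRight fun G => ⟨hadj.trans, hadj.symm.trans⟩), h₁, h₂⟩

/-! ### Walks of flags -/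

instance [Finite K] : Finite (CompleteFlag n K) :=
  Finite.of_injective CompleteFlag.space fun _ _ h => CompleteFlag.ext h

/-- The walks of flags along the word that start at `F₀` and end in the cell of `w`. -/
def walks (F₀ : CompleteFlag n K) (R : SimpleWord n) (w : Equiv.Perm (Fin n)) :
    Set (Fin (R.length + 1) → CompleteFlag n K) :=
  {F | F 0 = F₀ ∧ (∀ r : Fin R.length, IsAdjacent (R.get r) (F r.castSucc) (F r.succ)) ∧
    F (Fin.last R.length) ∈ schubertCell K w}

/-- Splitting off the first step of a walk. -/
def walksConsEquiv (F₀ : CompleteFlag n K) (i : Fin (n - 1)) (R : SimpleWord n)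
    (w : Equiv.Perm (Fin n)) :
    walks F₀ (i :: R) w ≃ Σ G : {G : CompleteFlag n K // IsAdjacent i F₀ G}, walks G.1 R w where
  toFun F := ⟨⟨F.1 (Fin.succ 0), by have := F.2.2.1 0; rwa [Fin.castSucc_zero, F.2.1] at this⟩,
    ⟨fun r => F.1 r.succ, rfl, fun r => F.2.2.1 r.succ, F.2.2.2⟩⟩
  invFun p := ⟨Fin.cons F₀ p.2.1, rfl, by
    intro r
    refine Fin.cases ?_ (fun r => ?_) r
    · change IsAdjacent i F₀ (p.2.1 0)
      rw [p.2.2.1]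
      exact p.1.2
    · exact p.2.2.2.1 r, p.2.2.2.2⟩
  left_inv F := by
    apply Subtype.ext
    funext r
    refine Fin.cases ?_ (fun r => ?_) r
    · exact F.2.1.symm
    · rfl
  right_inv p := by
    obtain ⟨⟨G, hG⟩, F, hF₀, hF⟩ := p
    change F 0 = G at hF₀
    subst hF₀
    rfl

lemma card_walks [Finite K] (w : Equiv.Perm (Fin n)) : ∀ (R : SimpleWord n)
    (v : Equiv.Perm (Fin n)) (F : CompleteFlag n K), F ∈ schubertCell K v →
      (Nat.card (walks F R w) : ℚ) = (walkPoly v R w).eval (Nat.card K : ℚ)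
  | [], v, F, hF => by
    rw [walkPoly]
    split_ifs with h
    · subst h
      have : Nat.card (walks F [] v) = 1 := by
        rw [Nat.card_eq_one_iff_unique]
        refine ⟨⟨fun a b => Subtype.ext (funext fun r => ?_)⟩,
          ⟨⟨fun _ => F, rfl, fun r => r.elim0, hF⟩⟩⟩
        have hr : r = 0 := Fin.ext (by simp)
        rw [hr, a.2.1, b.2.1]
      simp [this]
    · have : IsEmpty (walks F [] w) := by
        refine ⟨fun a => h (eq_of_mem_schubertCell hF ?_)⟩
        have := a.2.2.2
        rwa [show Fin.last ([] : SimpleWord n).length = 0 from rfl, a.2.1] at this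
      simp
  | i :: R, v, F, hF => by
    obtain ⟨e, h₁, h₂⟩ := exists_equiv_isAdjacent hF i
    have hfin := Fintype.ofFinite K
    rw [Nat.card_congr ((walksConsEquiv F i R w).trans
      (Equiv.sigmaCongrLeft (β := fun G => walks G.1 R w) e).symm), Nat.card_sigma,
      Fintype.sum_option, Nat.cast_add, Nat.cast_sum, card_walks w R _ _ h₁,
      Finset.sum_congr rfl fun t _ => card_walks w R _ _ (h₂ t)]
    simp [walkPoly, add_comm]

end Flags

/-! ### The Bott–Samelson distribution as a rational function -/

section RationalFunctions

variable {n : ℕ}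

/-- The standard flag. -/
def standardFlag (n : ℕ) (K : Type) [Field K] : CompleteFlag n K :=
  adaptedFlag (b := fun j => Pi.single j (1 : K)) (w := 1) fun j =>
    ⟨by simp, fun x hx => Pi.single_eq_of_ne hx.ne' _⟩

lemma standardFlag_space (K : Type) [Field K] (k : Fin (n + 1)) :
    (standardFlag n K).space k = coordSubspace K 1 k := by
  change initialSpan _ _ = _
  rw [initialSpan, coordSubspace]
  congr 1
  ext y
  constructor
  · rintro ⟨j, hj, rfl⟩
    exact ⟨j, hj, rfl⟩
  · rintro ⟨j, hj, rfl⟩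
    exact ⟨j, hj, rfl⟩

lemma bsProb_eq (K : Type) [Field K] [Finite K] (R : SimpleWord n) (w : Equiv.Perm (Fin n)) :
    bsProb K R w = (walkPoly 1 R w).eval (Nat.card K : ℚ) / ((Nat.card K : ℚ) + 1) ^ R.length := by
  have hmem : standardFlag n K ∈ schubertCell K 1 := adaptedFlag_mem_schubertCell _
  rw [bsProb, ← card_walks w R 1 _ hmem]
  congr 2
  refine Nat.card_congr
    { toFun := fun F => ⟨F.1.1, ?_, fun r k hk => F.1.2.2 r k hk, F.2⟩
      invFun := fun F => ⟨⟨F.1, fun k => ?_, fun r k hk => F.2.2.1 r k hk⟩, F.2.2.2⟩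
      left_inv := fun _ => rfl
      right_inv := fun _ => rfl }
  · ext1
    funext k
    rw [F.1.2.1, standardFlag_space]
  · rw [F.2.1, standardFlag_space]

/-- The Bott–Samelson distribution as a family of rational functions. -/
noncomputable def bsRatFunc (R : SimpleWord n) (w : Equiv.Perm (Fin n)) : RatFunc ℚ :=
  algebraMap ℚ[X] (RatFunc ℚ) (walkPoly 1 R w) /
    algebraMap ℚ[X] (RatFunc ℚ) ((X + 1) ^ R.length)

lemma eval_div_of_eval_ne_zero {k : Type*} [Field k] {p d : k[X]} {a : k} (hd : d.eval a ≠ 0) :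
    (algebraMap k[X] (RatFunc k) p / algebraMap k[X] (RatFunc k) d).denom.eval a ≠ 0 ∧
    (algebraMap k[X] (RatFunc k) p / algebraMap k[X] (RatFunc k) d).eval (RingHom.id k) a =
      p.eval a / d.eval a := by
  have hd₀ : d ≠ 0 := by rintro rfl; simp at hd
  have hden : (algebraMap k[X] (RatFunc k) p / algebraMap k[X] (RatFunc k) d).denom.eval a ≠ 0 := by
    intro h
    obtain ⟨c, hc⟩ := RatFunc.denom_div_dvd p d
    apply hd
    rw [hc, eval_mul, h, zero_mul]
  refine ⟨hden, ?_⟩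
  rw [RatFunc.eval, eval₂_id, eval₂_id, div_eq_div_iff hden hd]
  have h := RatFunc.num_div_denom
    (algebraMap k[X] (RatFunc k) p / algebraMap k[X] (RatFunc k) d)
  rw [div_eq_div_iff (RatFunc.algebraMap_ne_zero (RatFunc.denom_ne_zero _))
    (RatFunc.algebraMap_ne_zero hd₀), ← map_mul, ← map_mul] at h
  simpa using congrArg (Polynomial.eval a) (RatFunc.algebraMap_injective k h)

lemma isBSRatFunc_bsRatFunc (R : SimpleWord n) : IsBSRatFunc R (bsRatFunc R) := by
  intro K _ _ w
  have hd : ((X + 1 : ℚ[X]) ^ R.length).eval (Nat.card K : ℚ) ≠ 0 := by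
    rw [eval_pow, eval_add, eval_X, eval_one]
    positivity
  obtain ⟨h₁, h₂⟩ := eval_div_of_eval_ne_zero (p := walkPoly 1 R w) hd
  refine ⟨h₁, h₂.trans ?_⟩
  rw [bsProb_eq, eval_pow, eval_add, eval_X, eval_one]

lemma ratFunc_eq_of_infinite {k : Type*} [Field k] {x y : RatFunc k} {S : Set k}
    (hS : S.Infinite) (h : ∀ a ∈ S, x.denom.eval a ≠ 0 ∧ y.denom.eval a ≠ 0 ∧
      x.eval (RingHom.id k) a = y.eval (RingHom.id k) a) : x = y := by
  have hpoly : x.num * y.denom = y.num * x.denom := by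
    refine eq_of_infinite_eval_eq _ _ (hS.mono fun a ha => ?_)
    obtain ⟨h₁, h₂, h₃⟩ := h a ha
    rw [RatFunc.eval, RatFunc.eval, eval₂_id, eval₂_id, eval₂_id, eval₂_id,
      div_eq_div_iff h₁ h₂] at h₃
    simpa using h₃
  have hne : ∀ z : RatFunc k, algebraMap k[X] (RatFunc k) z.denom ≠ 0 := fun z =>
    RatFunc.algebraMap_ne_zero z.denom_ne_zero
  rw [← RatFunc.num_div_denom x, ← RatFunc.num_div_denom y, div_eq_div_iff (hne x) (hne y),
    ← map_mul, ← map_mul, hpoly]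

/-- The prime fields alone already give infinitely many evaluation points. -/
lemma eq_bsRatFunc {R : SimpleWord n} {P : Equiv.Perm (Fin n) → RatFunc ℚ}
    (hP : IsBSRatFunc R P) : P = bsRatFunc R := by
  funext w
  have hS : ((fun p : ℕ => (p : ℚ)) '' {p | p.Prime}).Infinite :=
    Nat.infinite_setOfPred_prime.image Nat.cast_injective.injOn
  refine ratFunc_eq_of_infinite hS ?_
  rintro _ ⟨p, hp, rfl⟩
  have : Fact p.Prime := ⟨hp⟩
  obtain ⟨h₁, h₂⟩ := hP (ZMod p) w
  obtain ⟨h₃, h₄⟩ := isBSRatFunc_bsRatFunc R (ZMod p) w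
  rw [Nat.card_zmod] at h₁ h₂ h₃ h₄
  exact ⟨h₁, h₃, h₂.trans h₄.symm⟩

lemma existsUnique_isBSRatFunc (R : SimpleWord n) :
    ∃! P : Equiv.Perm (Fin n) → RatFunc ℚ, IsBSRatFunc R P :=
  ⟨bsRatFunc R, isBSRatFunc_bsRatFunc R, fun _ => eq_bsRatFunc⟩

lemma walkPoly_eq_of_bsRatFunc_eq {R T : SimpleWord n} (hlen : R.length = T.length)
    (h : bsRatFunc R = bsRatFunc T) (w : Equiv.Perm (Fin n)) :
    walkPoly 1 R w = walkPoly 1 T w := by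
  have hne : algebraMap ℚ[X] (RatFunc ℚ) ((X + 1) ^ T.length) ≠ 0 :=
    RatFunc.algebraMap_ne_zero (pow_ne_zero _ (monic_X_add_C (1 : ℚ)).ne_zero)
  have := congrFun h w
  rw [bsRatFunc, bsRatFunc, hlen, div_left_inj' hne] at this
  exact RatFunc.algebraMap_injective ℚ this

end RationalFunctions

end BottSamelson

theorem mainTheorem4 (n : ℕ) (R₁ R₂ : SimpleWord n)
    (h₁ : R₁ ∈ reducedWords (longestPerm n)) (h₂ : R₂ ∈ reducedWords (longestPerm n))
    (hne : ¬ SameCommutationClass R₁ R₂) :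
    (∃! P₁ : Equiv.Perm (Fin n) → RatFunc ℚ, IsBSRatFunc R₁ P₁) ∧
    (∃! P₂ : Equiv.Perm (Fin n) → RatFunc ℚ, IsBSRatFunc R₂ P₂) ∧
    ∀ P₁ P₂ : Equiv.Perm (Fin n) → RatFunc ℚ,
      IsBSRatFunc R₁ P₁ → IsBSRatFunc R₂ P₂ → P₁ ≠ P₂ := by
  refine ⟨BottSamelson.existsUnique_isBSRatFunc R₁, BottSamelson.existsUnique_isBSRatFunc R₂,
    fun P₁ P₂ hP₁ hP₂ heq => hne ?_⟩
  rw [BottSamelson.eq_bsRatFunc hP₁, BottSamelson.eq_bsRatFunc hP₂] at heq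
  exact BottSamelson.sameCommutationClass_of_walkPoly_eq h₁ h₂ fun w =>
    BottSamelson.walkPoly_eq_of_bsRatFunc_eq (h₁.2.trans h₂.2.symm) heq w
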